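/- A numbering is a sequence $\varphi_0,\varphi_1,\varphi_2,\dots$ of partial functions from $\mathbb{N}$ to $\mathbb{N}$ such that $(e,x)\mapsto\varphi_e(x)$ is partial recursive. A numbering $\varphi$ has the Kolmogorov property if for every numbering $\psi$ there are a (not necessarily computable) function $t:\mathbb{N}\to\mathbb{N}$ and a positive constant $c$ such that $\varphi_{t(e)}=\psi_e$ and $t(e)\le ce+c$ for every index $e$. Write $\min_\varphi(x)$ for the least index $j$ with $\varphi_j=\varphi_x$. Theorem. Let $\varphi$ be a numbering with the Kolmogorov property, and let $f$ be a (total) computable function that maps each index $x\in\mathbb{N}$ to a finite list of indices containing $\min_\varphi(x)$. Then $|f(x)|=\Omega(\log^2 x)$ for infinitely many $x$; that is, there is a constant $c>0$ (which may depend on $\varphi$ and $f$) such that $|f(x)|\ge c\log^2 x$ for infinitely many $x$, where $|f(x)|$ is the number of distinct elements of the list $f(x)$. -/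

import Mathlib

/-- A numbering: a sequence `φ 0, φ 1, …` of partial functions on `ℕ` for which
`(e, x) ↦ φ e x` is a partial recursive function of the pair. -/
def IsNumbering (φ : ℕ → ℕ →. ℕ) : Prop :=
  Partrec₂ φ

/-- The Kolmogorov property: `φ` is a numbering, and every numbering `ψ` translates into `φ` by some
function `t`, not necessarily computable, that is bounded by `c * e + c` for a positive constant `c`
(which may depend on `ψ`). -/
def HasKolmogorovProperty (φ : ℕ → ℕ →. ℕ) : Prop :=
  IsNumbering φ ∧
    ∀ ψ : ℕ → ℕ →. ℕ, IsNumbering ψ →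
      ∃ t : ℕ → ℕ, (∀ e, φ (t e) = ψ e) ∧ ∃ c : ℕ, 0 < c ∧ ∀ e, t e ≤ c * e + c

/-- The set of minimal indices of `φ`. -/
def minimalIndices (φ : ℕ → ℕ →. ℕ) : Set ℕ :=
  {e | ∀ j < e, φ j ≠ φ e}

/-- The minimal index of the function `φ e`: the least `j` with `φ j = φ e`. -/
noncomputable def minIndex (φ : ℕ → ℕ →. ℕ) (e : ℕ) : ℕ :=
  sInf {j | φ j = φ e}

theorem minIndex_spec (φ : ℕ → ℕ →. ℕ) (e : ℕ) : φ (minIndex φ e) = φ e :=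
  Nat.sInf_mem (s := {j | φ j = φ e}) ⟨e, rfl⟩

theorem minIndex_mem (φ : ℕ → ℕ →. ℕ) (e : ℕ) : minIndex φ e ∈ minimalIndices φ := by
  intro j hj h
  exact Nat.notMem_of_lt_sInf (s := {j | φ j = φ e}) hj (h.trans (minIndex_spec φ e))

/-- `minIndex φ e` is the unique minimal index of `φ` that computes the function `φ e`. -/
theorem eq_minIndex_iff (φ : ℕ → ℕ →. ℕ) (e j : ℕ) :
    j = minIndex φ e ↔ j ∈ minimalIndices φ ∧ φ j = φ e := by
  constructor
  · rintro rfl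
    exact ⟨minIndex_mem φ e, minIndex_spec φ e⟩
  · rintro ⟨h1, h2⟩
    rcases lt_trichotomy j (minIndex φ e) with h | h | h
    · exact absurd (h2.trans (minIndex_spec φ e).symm) (minIndex_mem φ e j h)
    · exact h
    · exact absurd ((minIndex_spec φ e).trans h2.symm) (h1 _ h)

/-!
A numbering with the Kolmogorov property lets one compute, for each `y`, an index `g y = O(y)` of a
function with value `y` at `0`, so that the functions `φ (g y)` are pairwise different. Join `y` to
the members of the list `L y = f (g y)`. This is a computable graph, and `y` is joined to the
minimal index of `φ (g y)`.

The graph expands (`HasKolmogorovProperty.not_collapsed`): with a constant `a`, every set of `2 ^ k`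
points has at least `2 ^ k` neighbours below `2 ^ (k + a)`. For a set that violates this could be
found effectively, and a numbering could then use `2 ^ k` indices of size `O(2 ^ k)` to compute the
functions `φ (g y)` for `y` in the set. By the Kolmogorov property, the minimal indices of these
functions would be below `2 ^ (k + a)`; they are pairwise different, and each is a neighbour of its
`y`, so there would be too many of them.

A counting argument shows that an expanding graph has large degree
(`exists_mul_succ_le_card_of_expanding`). Take points `y` of about `n` bits and a scale `k` between
`n / 2` and `3 * n / 4`. If many points had only `d` neighbours in `[2 ^ (k - 1), 2 ^ (k + a))`, then
a random set of `2 ^ (k - 2)` elements of this interval would contain all those neighbours of a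
fraction `2 ^ (-O(d))` of the points, which contradicts expansion unless `d` is at least of order
`n`. The intervals of `Ω(n)` scales are disjoint, so some point has `Ω(n ^ 2)` neighbours, while
`log (g y) = O(n)`.
-/

/-! ### Computability of the auxiliary search -/

theorem Computable.list_flatMap_left {L : ℕ → List ℕ} (hL : Computable L) :
    Computable fun S : List ℕ => S.flatMap L := by
  have h : Computable₂ fun (S : List ℕ) (p : ℕ × List ℕ) =>
      p.2 ++ (Option.map L S[p.1]?).getD [] := by
    refine (Primrec.list_append.to_comp).comp (Computable.snd.comp Computable.snd) ?_
    refine Computable.option_getD (Computable.option_map ?_ (hL.comp Computable.snd))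
      (Computable.const _)
    exact Primrec.list_getElem?.to_comp.comp Computable.fst (Computable.fst.comp Computable.snd)
  refine (Computable.nat_rec (Primrec.list_length.to_comp) (Computable.const []) h).of_eq
    fun S => ?_
  have key : ∀ n ≤ S.length,
      Nat.rec [] (fun i IH => IH ++ (Option.map L S[i]?).getD []) n = (S.take n).flatMap L := by
    intro n hn
    induction n with
    | zero => simp
    | succ n ih =>
      have hn' : n < S.length := hn
      rw [List.take_add_one, List.flatMap_append, ← ih hn'.le]
      simp [hn']
  simpa using key S.length le_rfl

theorem Primrec.nat_log_two : Primrec (Nat.log 2) := by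
  have hpow : Primrec₂ ((· ^ ·) : ℕ → ℕ → ℕ) := Primrec₂.unpaired'.1 Nat.Primrec.pow
  have hrel : PrimrecRel fun n k : ℕ => 2 ^ k ≤ n :=
    Primrec.nat_le.comp (hpow.comp (Primrec.const 2) Primrec.snd) Primrec.fst
  refine (Primrec.nat_findGreatest Primrec.id hrel).of_eq fun n => ?_
  rcases Nat.eq_zero_or_pos n with rfl | hn
  · simp
  · rw [Nat.findGreatest_eq_iff]
    refine ⟨Nat.log_le_self 2 n, fun _ => Nat.pow_log_le_self 2 hn.ne', fun k hk _ h => ?_⟩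
    exact absurd (Nat.le_log_of_pow_le (by norm_num) h) (by simpa using hk)

/-- A list `S` of `m` distinct points is *collapsed below `b`* by the graph with neighbour lists
`L` if fewer than `m` vertices cover all the neighbours of `S` below `b`. -/
def Collapsed (L : ℕ → List ℕ) (m b : ℕ) (S : List ℕ) : Prop :=
  S.Nodup ∧ S.length = m ∧
    ∃ B : List ℕ, B.length < m ∧ ∀ z ∈ S.flatMap L, z < b → z ∈ B

/-- `Collapsed`, relative to a cover `B` and to the concatenation `T` of the neighbour lists, in a
visibly primitive recursive form. -/
def CollapsedWith (m b : ℕ) (S B T : List ℕ) : Prop :=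
  S.map (fun y => S.idxOf y) = List.range S.length ∧ S.length = m ∧ B.length < m ∧
    ∀ z ∈ T, z < b → ∃ w ∈ B, w = z

theorem map_idxOf_eq_range_iff (S : List ℕ) :
    S.map (fun y => S.idxOf y) = List.range S.length ↔ S.Nodup := by
  constructor
  · intro h
    exact List.Nodup.of_map _ (h ▸ List.nodup_range)
  · intro h
    refine List.ext_getElem (by simp) fun i h₁ h₂ => ?_
    simp [h.idxOf_getElem]

theorem primrecPred_collapsedWith :
    PrimrecPred fun q : (ℕ × ℕ) × (List ℕ × List ℕ × List ℕ) =>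
      CollapsedWith q.1.1 q.1.2 q.2.1 q.2.2.1 q.2.2.2 := by
  have hS : Primrec fun q : (ℕ × ℕ) × (List ℕ × List ℕ × List ℕ) => q.2.1 :=
    Primrec.fst.comp Primrec.snd
  have hB : Primrec fun q : (ℕ × ℕ) × (List ℕ × List ℕ × List ℕ) => q.2.2.1 :=
    Primrec.fst.comp (Primrec.snd.comp Primrec.snd)
  have hT : Primrec fun q : (ℕ × ℕ) × (List ℕ × List ℕ × List ℕ) => q.2.2.2 :=
    Primrec.snd.comp (Primrec.snd.comp Primrec.snd)
  have hm : Primrec fun q : (ℕ × ℕ) × (List ℕ × List ℕ × List ℕ) => q.1.1 :=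
    Primrec.fst.comp Primrec.fst
  have hb : Primrec fun q : (ℕ × ℕ) × (List ℕ × List ℕ × List ℕ) => q.1.2 :=
    Primrec.snd.comp Primrec.fst
  refine PrimrecPred.and ?_ (PrimrecPred.and ?_ (PrimrecPred.and ?_ ?_))
  · refine Primrec.eq.comp ?_ (Primrec.list_range.comp (Primrec.list_length.comp hS))
    exact Primrec.list_map hS
      (Primrec.list_idxOf.comp Primrec.snd (hS.comp Primrec.fst))
  · exact Primrec.eq.comp (Primrec.list_length.comp hS) hm
  · exact Primrec.nat_lt.comp (Primrec.list_length.comp hB) hm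
  · have h₁ : PrimrecRel fun (B : List ℕ) (z : ℕ) => ∃ w ∈ B, w = z :=
      PrimrecRel.exists_mem_list Primrec.eq
    have h₂ : PrimrecRel fun (z : ℕ) (p : ℕ × List ℕ) => z < p.1 → ∃ w ∈ p.2, w = z := by
      refine PrimrecPred.of_eq (PrimrecPred.or (PrimrecPred.not (Primrec.nat_lt.comp
        Primrec.fst (Primrec.fst.comp Primrec.snd)))
        (h₁.comp (Primrec.snd.comp Primrec.snd) Primrec.fst)) fun p => ?_
      tauto
    exact h₂.forall_mem_list.comp hT (hb.pair hB)

/-- A collapsed list can be found effectively, whenever there is one. -/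
theorem exists_partrec_collapsed {L : ℕ → List ℕ} (hL : Computable L) :
    ∃ s : ℕ × ℕ →. List ℕ, Partrec s ∧
      (∀ p, ∀ S ∈ s p, Collapsed L p.1 p.2 S) ∧
      ∀ p S, Collapsed L p.1 p.2 S → (s p).Dom := by
  obtain ⟨test, htest, hspec⟩ : ∃ test : (ℕ × ℕ) × (List ℕ × List ℕ × List ℕ) → Bool,
      Computable test ∧
        ∀ q, test q = true ↔ CollapsedWith q.1.1 q.1.2 q.2.1 q.2.2.1 q.2.2.2 := by
    obtain ⟨_, h⟩ := primrecPred_collapsedWith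
    exact ⟨_, h.to_comp, fun q => decide_eq_true_iff⟩
  let F : ℕ × ℕ → ℕ → Option (List ℕ) := fun p n =>
    (Encodable.decode (α := List ℕ × List ℕ) n).bind fun q =>
      bif test (p, (q.1, q.2, q.1.flatMap L)) then some q.1 else none
  have hF : Computable₂ F := by
    refine Computable.option_bind (Computable.decode.comp Computable.snd) ?_
    refine Computable.cond ?_ (Computable.option_some.comp (Computable.fst.comp Computable.snd))
      (Computable.const none)
    have h₁ : Computable fun r : ((ℕ × ℕ) × ℕ) × (List ℕ × List ℕ) =>
        (r.1.1, (r.2.1, r.2.2, r.2.1.flatMap L)) :=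
      (Computable.fst.comp Computable.fst).pair
        ((Computable.fst.comp Computable.snd).pair ((Computable.snd.comp Computable.snd).pair
          ((Computable.list_flatMap_left hL).comp (Computable.fst.comp Computable.snd))))
    exact htest.comp h₁
  refine ⟨fun p => Nat.rfindOpt (F p), Partrec.rfindOpt hF, ?_, ?_⟩
  · intro p S hS
    obtain ⟨n, hn⟩ := Nat.rfindOpt_spec hS
    simp only [F, Option.mem_def, Option.bind_eq_some_iff] at hn
    obtain ⟨q, -, hq⟩ := hn
    cases h : test (p, (q.1, q.2, q.1.flatMap L))
    · simp [h] at hq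
    · simp only [h, cond_true, Option.some.injEq] at hq
      subst hq
      obtain ⟨h₁, h₂, h₃, h₄⟩ := (hspec _).1 h
      exact ⟨(map_idxOf_eq_range_iff _).1 h₁, h₂, q.2, h₃, fun z hz hb => by
        obtain ⟨w, hw, rfl⟩ := h₄ z hz hb
        exact hw⟩
  · rintro p S ⟨h₁, h₂, B, h₃, h₄⟩
    refine Nat.rfindOpt_dom.2 ⟨Encodable.encode (S, B), S, ?_⟩
    have h : test (p, (S, B, S.flatMap L)) = true := (hspec _).2
      ⟨(map_idxOf_eq_range_iff _).2 h₁, h₂, h₃, fun z hz hb => ⟨z, h₄ z hz hb, rfl⟩⟩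
    simp [F, h]

/-- In a numbering with the Kolmogorov property one can compute, for each `y`, an index
`g y = O(y)` of a function with value `y` at `0`; distinct `y` thus get distinct functions. -/
theorem HasKolmogorovProperty.exists_computable_index {φ : ℕ → ℕ →. ℕ}
    (hφ : HasKolmogorovProperty φ) :
    ∃ (g : ℕ → ℕ) (c : ℕ), Computable g ∧ (∀ y, y ∈ φ (g y) 0) ∧ ∀ y, g y ≤ c * y + c := by
  obtain ⟨t, ht, c, -, htc⟩ := hφ.2 (fun e _ => Part.some e)
    (Computable.fst.partrec : Partrec fun p : ℕ × ℕ => Part.some p.1)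
  obtain ⟨C, hC⟩ := Nat.Partrec.Code.exists_code.1 (Partrec₂.unpaired'.2 hφ.1)
  let P : ℕ → ℕ → Prop := fun y n => n.unpair.1 ≤ c * y + c ∧
    Nat.Partrec.Code.evaln n.unpair.2 C (Nat.pair n.unpair.1 0) = some y
  have hP : ComputablePred fun p : ℕ × ℕ => P p.1 p.2 := by
    have h₁ : Primrec fun p : ℕ × ℕ => p.2.unpair.1 :=
      Primrec.fst.comp (Primrec.unpair.comp Primrec.snd)
    have h₂ : Primrec fun p : ℕ × ℕ => p.2.unpair.2 :=
      Primrec.snd.comp (Primrec.unpair.comp Primrec.snd)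
    refine PrimrecPred.computablePred (PrimrecPred.and (Primrec.nat_le.comp h₁ ?_)
      (Primrec.eq.comp ?_ (Primrec.option_some.comp Primrec.fst)))
    · exact Primrec.nat_add.comp (Primrec.nat_mul.comp (Primrec.const c) Primrec.fst)
        (Primrec.const c)
    · exact Nat.Partrec.Code.primrec_evaln.comp
        ((h₂.pair (Primrec.const C)).pair (Primrec₂.natPair.comp h₁ (Primrec.const 0)))
  have hex : ∀ y, ∃ n, P y n := by
    intro y
    have : y ∈ C.eval (Nat.pair (t y) 0) := by
      rw [hC]; simp [ht]
    obtain ⟨s, hs⟩ := Nat.Partrec.Code.evaln_complete.1 this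
    exact ⟨Nat.pair (t y) s, by simpa [P] using ⟨htc y, hs⟩⟩
  classical
  obtain ⟨w, hw, hwP⟩ : ∃ w : ℕ → ℕ, Computable w ∧ ∀ y, P y (w y) :=
    ⟨_, Computable.find hP hex, fun y => Nat.find_spec (hex y)⟩
  refine ⟨fun y => (w y).unpair.1, c,
    (Primrec.fst.comp Primrec.unpair).to_comp.comp hw, fun y => ?_, fun y => (hwP y).1⟩
  have := Nat.Partrec.Code.evaln_sound (hwP y).2
  rw [hC] at this
  simpa using this

/-- Lists `L y` that contain the minimal index of `φ (g y)` admit no collapsed list of length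
`2 ^ k` below `2 ^ (k + a)`, for a suitable `a` and all `k` whose binary length codes this `a`.
Otherwise a numbering could search for such a collapsed list and compute the functions `φ (g y)`,
for `y` in the list, at the indices `2 ^ k, …, 2 ^ (k + 1) - 1`; this would push all their minimal
indices below `2 ^ (k + a)`, where too few vertices are available for them.

The numbering has to know `a`, while `a` depends on its translation constant. The dependence is
broken by reading `a` off `k`, so that one numbering serves all values of `a`. -/
theorem HasKolmogorovProperty.not_collapsed {φ : ℕ → ℕ →. ℕ}
    (hφ : HasKolmogorovProperty φ) {g : ℕ → ℕ} (hg : Computable g) (hgφ : ∀ y, y ∈ φ (g y) 0)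
    {L : ℕ → List ℕ} (hL : Computable L) (hmin : ∀ y, minIndex φ (g y) ∈ L y) :
    ∃ a : ℕ, ∀ k, (Nat.log 2 k).unpair.1 = a → ∀ S, ¬ Collapsed L (2 ^ k) (2 ^ (k + a)) S := by
  obtain ⟨s, hs, hs₁, hs₂⟩ := exists_partrec_collapsed hL
  let prm : ℕ → ℕ × ℕ := fun e =>
    (2 ^ Nat.log 2 e, 2 ^ (Nat.log 2 e + (Nat.log 2 (Nat.log 2 e)).unpair.1))
  have hprm : Computable prm := by
    have hpow : Primrec₂ ((· ^ ·) : ℕ → ℕ → ℕ) := Primrec₂.unpaired'.1 Nat.Primrec.pow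
    have h₁ := Primrec.nat_log_two
    refine Primrec.to_comp (Primrec.pair (hpow.comp (Primrec.const 2) h₁)
      (hpow.comp (Primrec.const 2) (Primrec.nat_add.comp h₁ ?_)))
    exact Primrec.fst.comp (Primrec.unpair.comp (h₁.comp h₁))
  let ψ : ℕ → ℕ →. ℕ := fun e x =>
    (s (prm e)).bind fun S => φ (g (S.getD (e - (prm e).1) 0)) x
  have hψ : IsNumbering ψ := by
    have h₁ : Partrec fun p : ℕ × ℕ => s (prm p.1) := hs.comp (hprm.comp Computable.fst)
    refine Partrec.bind h₁ ?_
    refine Partrec₂.comp hφ.1 (hg.comp ((Primrec.list_getD 0).to_comp.comp Computable.snd ?_))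
      (Computable.snd.comp Computable.fst)
    exact Primrec.nat_sub.to_comp.comp (Computable.fst.comp Computable.fst)
      (Computable.fst.comp (hprm.comp (Computable.fst.comp Computable.fst)))
  obtain ⟨t, ht, c, -, htc⟩ := hφ.2 ψ hψ
  -- Any `a` with `2 * c ≤ 2 ^ a` would do.
  refine ⟨2 * c, fun k hk S₀ hS₀ => ?_⟩
  obtain ⟨S, hS⟩ := Part.dom_iff_mem.1 (hs₂ (2 ^ k, 2 ^ (k + 2 * c)) S₀ hS₀)
  obtain ⟨hnd, hlen, B, hB, hcov⟩ := hs₁ _ _ hS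
  simp only at hlen hB hcov
  have hinj : ∀ y y', minIndex φ (g y) = minIndex φ (g y') → y = y' := by
    intro y y' h
    have h₁ := minIndex_spec φ (g y)
    rw [h, minIndex_spec φ (g y')] at h₁
    exact Part.mem_unique (hgφ y) (h₁ ▸ hgφ y')
  have hmem : ∀ y ∈ S, minIndex φ (g y) ∈ B := by
    intro y hy
    refine hcov _ (List.mem_flatMap.2 ⟨y, hy, hmin y⟩) ?_
    obtain ⟨i, hi, rfl⟩ := List.getElem_of_mem hy
    have hi' : i < 2 ^ k := hlen ▸ hi
    have hlog : Nat.log 2 (2 ^ k + i) = k :=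
      (Nat.log_eq_iff (Or.inr ⟨by norm_num, by positivity⟩)).2 ⟨by omega, by rw [pow_succ]; omega⟩
    have hψe : ψ (2 ^ k + i) = φ (g S[i]) := by
      funext x
      have hp : prm (2 ^ k + i) = (2 ^ k, 2 ^ (k + 2 * c)) := by simp only [prm, hlog, hk]
      simp only [ψ, hp]
      rw [Part.eq_some_iff.2 hS]
      simp [hi]
    have hle : minIndex φ (g S[i]) ≤ t (2 ^ k + i) :=
      Nat.sInf_le (by rw [Set.mem_ofPred_eq, ht, hψe])
    have h2c : 2 * c < 2 ^ (2 * c) := Nat.lt_two_pow_self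
    calc minIndex φ (g S[i]) ≤ c * (2 ^ k + i) + c := hle.trans (htc _)
      _ = c * (2 ^ k + i + 1) := by ring
      _ ≤ c * (2 * 2 ^ k) := Nat.mul_le_mul_left _ (by omega)
      _ = 2 ^ k * (2 * c) := by ring
      _ < 2 ^ k * 2 ^ (2 * c) := Nat.mul_lt_mul_of_pos_left h2c (by positivity)
      _ = 2 ^ (k + 2 * c) := by rw [pow_add]
  have hcard : (S.toFinset.image fun y => minIndex φ (g y)).card ≤ B.toFinset.card := by
    refine Finset.card_le_card fun z hz => ?_
    obtain ⟨y, hy, rfl⟩ := Finset.mem_image.1 hz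
    exact List.mem_toFinset.2 (hmem y (List.mem_toFinset.1 hy))
  rw [Finset.card_image_of_injective _ (fun y y' h => hinj y y' h),
    List.toFinset_card_of_nodup hnd, hlen] at hcard
  exact absurd (hcard.trans (List.toFinset_card_le B)) (not_le.2 hB)

/-! ### Quadratic degree of expanding graphs -/

theorem Nat.choose_le_pow_mul_choose_sub {N m q d : ℕ} (hd : d ≤ m) (hN : N ≤ q * (m - d)) :
    N.choose m ≤ q ^ d * (N - d).choose (m - d) := by
  induction d with
  | zero => simp
  | succ d ih =>
    have ih' := ih (by omega) (hN.trans (Nat.mul_le_mul_left _ (by omega)))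
    refine ih'.trans ?_
    rw [pow_succ, mul_assoc]
    refine Nat.mul_le_mul_left _ ?_
    rcases Nat.eq_zero_or_pos (N - d) with h0 | h0
    · rw [h0, Nat.choose_eq_zero_of_lt (by omega)]
      exact Nat.zero_le _
    · obtain ⟨M, hM⟩ := Nat.exists_eq_succ_of_ne_zero h0.ne'
      obtain ⟨j, hj⟩ : ∃ j, m - d = j + 1 := ⟨m - d - 1, by omega⟩
      have hM' : N - (d + 1) = M := by omega
      have hj' : m - (d + 1) = j := by omega
      rw [hM, hj, hM', hj']
      rw [hj'] at hN
      refine Nat.le_of_mul_le_mul_right (c := j + 1) ?_ (Nat.succ_pos j)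
      calc (M + 1).choose (j + 1) * (j + 1) = (M + 1) * M.choose j :=
            (Nat.add_one_mul_choose_eq M j).symm
        _ ≤ (q * (j + 1)) * M.choose j := by
            refine Nat.mul_le_mul_right _ ?_
            have : q * j ≤ q * (j + 1) := Nat.mul_le_mul_left _ (by omega)
            omega
        _ = q * M.choose j * (j + 1) := by ring

/-- Averaging over all `m`-element subsets of `P`: one of them contains at least a proportion
`q⁻ᵈ` of a family of subsets of `P` of size at most `d`, if `P` has at most `q * (m - d)`
elements. -/
theorem Finset.exists_card_eq_and_card_le_pow_mul_card_filter_subset {P Y : Finset ℕ}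
    {A : ℕ → Finset ℕ} {d m q : ℕ} (hq : 0 < q) (hAP : ∀ y ∈ Y, A y ⊆ P)
    (hAd : ∀ y ∈ Y, (A y).card ≤ d) (hdm : d ≤ m) (hm : m ≤ P.card) (hP : P.card ≤ q * (m - d)) :
    ∃ B ⊆ P, B.card = m ∧ Y.card ≤ q ^ d * (Y.filter fun y => A y ⊆ B).card := by
  have hne : (P.powersetCard m).Nonempty := Finset.powersetCard_nonempty.2 hm
  have hy : ∀ y ∈ Y, P.card.choose m ≤
      q ^ d * ((P.powersetCard m).filter (A y ⊆ ·)).card := by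
    intro y hy
    rw [Finset.card_filter_powersetCard_subset _ _ _ (hAP y hy) ((hAd y hy).trans hdm)]
    refine (Nat.choose_le_pow_mul_choose_sub ((hAd y hy).trans hdm)
      (hP.trans (Nat.mul_le_mul_left _ (by have := hAd y hy; omega)))).trans ?_
    exact Nat.mul_le_mul_right _ (Nat.pow_le_pow_right hq (hAd y hy))
  have hsum : ∑ _B ∈ P.powersetCard m, Y.card ≤
      ∑ B ∈ P.powersetCard m, q ^ d * (Y.filter fun y => A y ⊆ B).card := by
    calc ∑ _B ∈ P.powersetCard m, Y.card = ∑ _y ∈ Y, P.card.choose m := by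
          simp [Finset.card_powersetCard, mul_comm]
      _ ≤ ∑ y ∈ Y, q ^ d * ((P.powersetCard m).filter (A y ⊆ ·)).card := Finset.sum_le_sum hy
      _ = ∑ B ∈ P.powersetCard m, q ^ d * (Y.filter fun y => A y ⊆ B).card := by
          rw [← Finset.mul_sum, ← Finset.mul_sum]
          simp only [Finset.card_filter]
          rw [Finset.sum_comm]
  obtain ⟨B, hB, h⟩ := Finset.exists_le_of_sum_le hne hsum
  obtain ⟨hBP, hBm⟩ := Finset.mem_powersetCard.1 hB
  exact ⟨B, hBP, hBm, h⟩

/-- If no set of `2 ^ k` points, for `h ≤ k < 2 * h`, has its neighbours below `2 ^ (k + a)` covered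
by fewer than `2 ^ k` vertices, then some point between `2 ^ (2 * h)` and `2 ^ (2 * h + 1)` has a
number of neighbours quadratic in `h`. Otherwise, as the intervals `[2 ^ (k - 1), 2 ^ (k + a))` are
disjoint for `k = h + (a + 1) * r`, many points have few neighbours in the same one of them, and a
suitable set of `2 ^ (k - 2)` elements of this interval, together with all numbers below
`2 ^ (k - 1)`, covers the neighbours below `2 ^ (k + a)` of `2 ^ k` points. -/
theorem exists_mul_succ_le_card_of_expanding {L : ℕ → Finset ℕ} {a h R : ℕ} (hR : 0 < R)
    (hRh : 4 * (a + 3) * R ≤ h)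
    (hL : ∀ k, h ≤ k → k < 2 * h → ∀ S B : Finset ℕ, S.card = 2 ^ k → B.card < 2 ^ k →
      ¬ ∀ y ∈ S, ∀ z ∈ L y, z < 2 ^ (k + a) → z ∈ B) :
    ∃ y ∈ Finset.Ico (2 ^ (2 * h)) (2 ^ (2 * h + 1)), R * (R + 1) ≤ (L y).card := by
  by_contra! hcon
  set Y := Finset.Ico (2 ^ (2 * h)) (2 ^ (2 * h + 1)) with hY
  have hYcard : Y.card = 2 ^ (2 * h) := by
    rw [hY, Nat.card_Ico, pow_succ]; omega
  have haR : 4 * (a * R) + 12 * R ≤ h := by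
    calc 4 * (a * R) + 12 * R = 4 * (a + 3) * R := by ring
      _ ≤ h := hRh
  let P : ℕ → Finset ℕ := fun r =>
    Finset.Ico (2 ^ (h + (a + 1) * r - 1)) (2 ^ (h + (a + 1) * r + a))
  -- The upper end of `P r` is the lower end of `P (r + 1)`.
  have hdisj : ∀ r r', r < r' → Disjoint (P r) (P r') := by
    intro r r' hr
    refine Finset.disjoint_left.2 fun z hz hz' => ?_
    have h₁ := (Finset.mem_Ico.1 hz).2
    have h₂ := (Finset.mem_Ico.1 hz').1
    have h₃ : h + (a + 1) * r + a ≤ h + (a + 1) * r' - 1 := by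
      have := Nat.mul_le_mul_left (a + 1) (Nat.succ_le_of_lt hr)
      rw [Nat.mul_succ] at this
      omega
    have h₄ : 2 ^ (h + (a + 1) * r + a) ≤ 2 ^ (h + (a + 1) * r' - 1) :=
      Nat.pow_le_pow_right (by norm_num) h₃
    omega
  -- The intervals share out fewer than `R * (R + 1)` neighbours.
  have hfew : ∀ y ∈ Y, ∃ r ∈ Finset.range R, (L y ∩ P r).card ≤ R := by
    intro y hy
    by_contra! hc
    have h₁ : ((Finset.range R).biUnion fun r => L y ∩ P r).card ≤ (L y).card :=
      Finset.card_le_card (Finset.biUnion_subset.2 fun r _ => Finset.inter_subset_left)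
    rw [Finset.card_biUnion] at h₁
    · have h₂ : ∑ _r ∈ Finset.range R, (R + 1) ≤ ∑ r ∈ Finset.range R, (L y ∩ P r).card :=
        Finset.sum_le_sum hc
      simp only [Finset.sum_const, Finset.card_range, smul_eq_mul] at h₂
      have := hcon y hy
      omega
    · intro r _ r' _ hne
      refine Disjoint.mono Finset.inter_subset_right Finset.inter_subset_right ?_
      rcases lt_or_gt_of_ne hne with hlt | hlt
      · exact hdisj r r' hlt
      · exact (hdisj r' r hlt).symm
  let Z : ℕ → Finset ℕ := fun r => Y.filter fun y => (L y ∩ P r).card ≤ R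
  obtain ⟨r, hr, hZ⟩ : ∃ r ∈ Finset.range R, 2 ^ (2 * h) ≤ R * (Z r).card := by
    refine Finset.exists_le_of_sum_le (Finset.nonempty_range_iff.2 hR.ne') ?_
    rw [Finset.sum_const, Finset.card_range, smul_eq_mul, ← Finset.mul_sum, ← hYcard]
    refine Nat.mul_le_mul_left _ ((Finset.card_le_card fun y hy => ?_).trans
      Finset.card_biUnion_le)
    obtain ⟨r, hr, hyr⟩ := hfew y hy
    exact Finset.mem_biUnion.2 ⟨r, hr, Finset.mem_filter.2 ⟨hy, hyr⟩⟩
  obtain ⟨k, hk⟩ : ∃ k, k = h + (a + 1) * r := ⟨_, rfl⟩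
  have hkh : k ≤ h + (a * R + R) := by
    have := Nat.mul_le_mul_left (a + 1) (Finset.mem_range.1 hr).le
    rw [hk]
    linarith [add_mul a 1 R]
  have hhk : h ≤ k := by omega
  have hPr : P r = Finset.Ico (2 ^ (k - 1)) (2 ^ (k + a)) := by simp only [P, hk]
  obtain ⟨j, rfl⟩ : ∃ j, k = j + 3 := ⟨k - 3, by omega⟩
  have hRj : R ≤ 2 ^ j :=
    Nat.lt_two_pow_self.le.trans (Nat.pow_le_pow_right (by norm_num) (by omega))
  have e₁ : 2 ^ (j + 3 - 1) = 4 * 2 ^ j := by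
    rw [show j + 3 - 1 = j + 2 by omega, pow_add]; ring
  have e₂ : 2 ^ (j + 3) = 8 * 2 ^ j := by rw [pow_add]; ring
  have e₃ : 2 ^ (j + 3 + a) = 8 * 2 ^ j * 2 ^ a := by rw [pow_add, e₂]
  have e₄ : 1 ≤ 2 ^ a := Nat.one_le_two_pow
  have hPcard : (P r).card = 8 * 2 ^ j * 2 ^ a - 4 * 2 ^ j := by
    rw [hPr, Nat.card_Ico, e₁, e₃]
  have e₅ : 8 * 2 ^ j * 1 ≤ 8 * 2 ^ j * 2 ^ a := Nat.mul_le_mul_left _ e₄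
  obtain ⟨B, -, hBcard, hB⟩ :=
    Finset.exists_card_eq_and_card_le_pow_mul_card_filter_subset (P := P r) (Y := Z r)
      (A := fun y => L y ∩ P r) (d := R) (m := 2 * 2 ^ j) (q := 2 ^ (a + 3)) (by positivity)
      (fun y _ => Finset.inter_subset_right) (fun y hy => (Finset.mem_filter.1 hy).2)
      (by omega) (by omega) (by
        calc (P r).card ≤ 8 * 2 ^ j * 2 ^ a := by omega
          _ = 2 ^ (a + 3) * 2 ^ j := by rw [pow_add]; ring
          _ ≤ _ := Nat.mul_le_mul_left _ (by omega))
  -- The density of the good points is at least `1 / (R * 2 ^ ((a + 3) * R))`, which outweighs the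
  -- gap between `k` and `2 * h` because `(a + 3) * R` is a small fraction of `h`.
  set T := (Z r).filter fun y => L y ∩ P r ⊆ B
  have hT : 2 ^ (j + 3) ≤ T.card := by
    refine le_of_mul_le_mul_left (a := 2 ^ R * (2 ^ (a + 3)) ^ R) ?_ (by positivity)
    calc 2 ^ R * (2 ^ (a + 3)) ^ R * 2 ^ (j + 3) = 2 ^ (R + (a + 3) * R + (j + 3)) := by
          rw [← pow_mul, ← pow_add, ← pow_add]
      _ ≤ 2 ^ (2 * h) := by
          refine Nat.pow_le_pow_right (by norm_num) ?_
          rw [add_mul]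
          omega
      _ ≤ R * (Z r).card := hZ
      _ ≤ 2 ^ R * ((2 ^ (a + 3)) ^ R * T.card) := Nat.mul_le_mul Nat.lt_two_pow_self.le hB
      _ = _ := by ring
  obtain ⟨S, hST, hS⟩ := Finset.exists_subset_card_eq hT
  refine hL (j + 3) hhk (by omega) S (Finset.range (2 ^ (j + 3 - 1)) ∪ B) hS ?_ ?_
  · refine (Finset.card_union_le _ _).trans_lt ?_
    rw [Finset.card_range, hBcard, e₁, e₂]
    have : 0 < 2 ^ j := by positivity
    omega
  · intro y hy z hz hzk
    rcases lt_or_ge z (2 ^ (j + 3 - 1)) with hlt | hge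
    · exact Finset.mem_union_left _ (Finset.mem_range.2 hlt)
    · refine Finset.mem_union_right _ ((Finset.mem_filter.1 (hST hy)).2 ?_)
      rw [hPr]
      exact Finset.mem_inter.2 ⟨hz, Finset.mem_Ico.2 ⟨hge, hzk⟩⟩

/-! ### The lower bound -/

theorem theoremt (φ : ℕ → ℕ →. ℕ) (hφ : HasKolmogorovProperty φ)
    (f : ℕ → List ℕ) (hf : Computable f) (hmin : ∀ x, minIndex φ x ∈ f x) :
    ∃ c : ℝ, 0 < c ∧
      {x : ℕ | c * Real.log (x : ℝ) ^ 2 ≤ ((f x).toFinset.card : ℝ)}.Infinite := by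
  obtain ⟨g, c, hg, hgφ, hgc⟩ := hφ.exists_computable_index
  obtain ⟨a, ha⟩ := hφ.not_collapsed hg hgφ (hf.comp hg) fun y => hmin (g y)
  have hginj : Function.Injective g := fun y y' h =>
    Part.mem_unique (hgφ y) (h ▸ hgφ y')
  obtain ⟨v, hv⟩ : ∃ v, v = 4 * (a + 3) := ⟨_, rfl⟩
  let K : ℝ := (c + 3) * (2 * v)
  have hvpos : (0 : ℝ) < v := by rw [hv]; positivity
  have hK : 0 < K := by positivity
  refine ⟨1 / K ^ 2, by positivity, ?_⟩
  refine Set.Infinite.mono (s := g '' {y | 1 / K ^ 2 * Real.log (g y : ℝ) ^ 2 ≤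
    ((f (g y)).toFinset.card : ℝ)}) (by rintro _ ⟨y, hy, rfl⟩; exact hy) ?_
  refine Set.Infinite.image hginj.injOn (Set.infinite_of_forall_exists_gt fun b => ?_)
  -- Every `a` is the first component of arbitrarily large codes `l` of pairs.
  obtain ⟨l, hl⟩ : ∃ l, l = Nat.pair a (b + v) := ⟨_, rfl⟩
  have hlb : b + v ≤ l := hl ▸ Nat.right_le_pair a (b + v)
  obtain ⟨h, hh⟩ : ∃ h, h = 2 ^ l := ⟨_, rfl⟩
  have hlh : l < h := hh ▸ Nat.lt_two_pow_self
  obtain ⟨R, hRdef⟩ : ∃ R, R = h / v := ⟨_, rfl⟩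
  have hv0 : 0 < v := by omega
  have hR : 0 < R := hRdef ▸ Nat.div_pos (by omega) hv0
  have hRh : v * R ≤ h := hRdef ▸ Nat.mul_div_le h v
  have hhR : h ≤ 2 * v * R := by
    have h₁ : h < v * (R + 1) := hRdef ▸ Nat.lt_mul_div_succ h hv0
    have h₂ : v * 1 ≤ v * R := Nat.mul_le_mul_left v hR
    have h₃ : v * (R + 1) = v * R + v * 1 := by ring
    have h₄ : 2 * v * R = 2 * (v * R) := by ring
    omega
  obtain ⟨y, hy, hycard⟩ := exists_mul_succ_le_card_of_expanding (L := fun y => (f (g y)).toFinset)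
    (a := a) hR (hv ▸ hRh) (by
      intro k hk₁ hk₂ S B hS hB hcov
      refine ha k ?_ S.toList ⟨S.nodup_toList, by simpa using hS, B.toList, by simpa using hB, ?_⟩
      · have : Nat.log 2 k = l :=
          (Nat.log_eq_iff (Or.inr ⟨by norm_num, by omega⟩)).2
            ⟨by omega, by rw [pow_succ]; omega⟩
        rw [this, hl, Nat.unpair_pair]
      · intro z hz hzk
        obtain ⟨y, hy, hzy⟩ := List.mem_flatMap.1 hz
        exact Finset.mem_toList.2
          (hcov y (Finset.mem_toList.1 hy) z (List.mem_toFinset.2 hzy) hzk))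
  obtain ⟨hy₁, hy₂⟩ := Finset.mem_Ico.1 hy
  have h2h : 2 * h < 2 ^ (2 * h) := Nat.lt_two_pow_self
  refine ⟨y, ?_, by omega⟩
  have hlog : Real.log (g y) ≤ (c + 3) * h := by
    rcases Nat.eq_zero_or_pos (g y) with h0 | h0
    · rw [h0, Nat.cast_zero, Real.log_zero]; positivity
    have hle : g y ≤ (c + 1) * 2 ^ (2 * h + 1) := by
      calc g y ≤ c * (y + 1) := (hgc y).trans_eq (by ring)
        _ ≤ (c + 1) * 2 ^ (2 * h + 1) := Nat.mul_le_mul (by omega) (by omega)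
    have hle' : (g y : ℝ) ≤ (c + 1) * 2 ^ (2 * h + 1) := by exact_mod_cast hle
    have h₁ : Real.log (c + 1) ≤ c := by
      have := Real.log_le_sub_one_of_pos (show (0 : ℝ) < c + 1 by positivity)
      linarith
    have h₂ : Real.log 2 ≤ 1 := by
      have := Real.log_le_sub_one_of_pos (show (0 : ℝ) < 2 by norm_num)
      linarith
    have h₃ : (1 : ℝ) ≤ h := by exact_mod_cast (by omega : 1 ≤ h)
    calc Real.log (g y) ≤ Real.log ((c + 1) * 2 ^ (2 * h + 1)) :=
          Real.log_le_log (by exact_mod_cast h0) hle'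
      _ = Real.log (c + 1) + (2 * h + 1) * Real.log 2 := by
          rw [Real.log_mul (by positivity) (by positivity), Real.log_pow]; push_cast; ring
      _ ≤ c + (2 * h + 1) * 1 := by gcongr
      _ ≤ (c + 3) * h := by nlinarith [(Nat.cast_nonneg c : (0 : ℝ) ≤ c)]
  have hlogK : Real.log (g y) ≤ K * R := by
    have : (h : ℝ) ≤ 2 * v * R := by exact_mod_cast hhR
    calc Real.log (g y) ≤ (c + 3) * h := hlog
      _ ≤ (c + 3) * (2 * v * R) := by gcongr
      _ = K * R := by ring
  rw [Set.mem_ofPred_eq]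
  calc 1 / K ^ 2 * Real.log (g y) ^ 2 ≤ 1 / K ^ 2 * (K * R) ^ 2 := by
        gcongr
    _ = (R * R : ℝ) := by field_simp
    _ ≤ ((R * (R + 1) : ℕ) : ℝ) := by push_cast; gcongr; linarith
    _ ≤ _ := by exact_mod_cast hycard
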